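/- Let $H_m$ be the space of $m\times m$ complex Hermitian matrices. Partitions are written $\tau=(\tau_1\ge\dots\ge\tau_m\ge 0)$, with weight $|\tau|=\sum_i\tau_i$. Put $$\Gamma_m(a)=\pi^{m(m-1)/2}\prod_{r=1}^m\Gamma(a-r+1),\qquad (a)_\tau=\prod_{r=1}^m\frac{\Gamma(a+\tau_r-r+1)}{\Gamma(a-r+1)},\qquad V(x)=\prod_{i<j}(x_i-x_j).$$ Let $s_\tau(x)=\det(x_i^{\tau_j+m-j})/\det(x_i^{m-j})$ be the Schur polynomial, and let the zonal polynomial $C_\tau$ be the multiple of $s_\tau$, evaluated at the eigenvalues of a matrix $X\in H_m$, with the normalization $(\operatorname{tr}X)^k=\sum_{|\tau|=k}C_\tau(X)$ for all $k\ge 0$. For real parameters set $${}_pF_q\big((a_i)_{1\le i\le p},(e_j)_{1\le j\le q};B,C\big)=\sum_{k\ge0}\sum_{|\tau|=k}\frac{\prod_{i=1}^p(a_i)_\tau\,C_\tau(B)\,C_\tau(C)}{\prod_{j=1}^q(e_j)_\tau\,C_\tau(I)\,k!},\qquad {}_p\mathcal F_q\big((a_i),(e_j);z\big)=\sum_{k\ge0}\frac{\prod_{i=1}^p(a_i)_k}{\prod_{j=1}^q(e_j)_k}\frac{z^k}{k!},$$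 where $(a)_k=a(a+1)\cdots(a+k-1)$. Lemma 3. Let $B,C\in H_m$ have eigenvalues $b_1,\dots,b_m$ and $c_1,\dots,c_m$ (with multiplicity, in any order), and let $\mu_1,\dots,\mu_p>-1$ and $\phi_1,\dots,\phi_q>-1$ be real. Assume that $p\le q$, or that $p=q+1$ and $|b_lc_f|<1$ for all $l,f$. Then the series defining ${}_pF_q((m+\mu_i),(m+\phi_j);B,C)$ and ${}_p\mathcal F_q((\mu_i+1),(1+\phi_j);b_lc_f)$, $1\le l,f\le m$, converge absolutely, and $${}_pF_q\big((m+\mu_i)_{1\le i\le p},(m+\phi_j)_{1\le j\le q};B,C\big)=\pi^{\frac{m(m-1)}2(p-q-1)}\,\Gamma_m(m)\prod_{i=1}^p\frac{\Gamma(\mu_i+1)^m}{\Gamma_m(m+\mu_i)}\prod_{j=1}^q\frac{\Gamma_m(m+\phi_j)}{\Gamma(\phi_j+1)^m}\;\frac{\det\big({}_p\mathcal F_q((\mu_i+1)_{1\le i\le p},(1+\phi_j)_{1\le j\le q};b_lc_f)\big)_{1\le l,f\le m}}{V(b)\,V(c)}.$$ This holds literally if the $b_l$ are pairwise distinct and the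 $c_f$ are pairwise distinct. In every case, including repeated eigenvalues, the right-hand side, as a function of vectors $(x,y)\in\mathbb R^m\times\mathbb R^m$ with pairwise distinct coordinates in $x$ and in $y$, tends to the left-hand side as $(x,y)\to(b,c)$. -/

import Mathlib

open scoped BigOperators Topology

namespace HermitianHypergeometric

noncomputable section

/-! ### Gamma factors and Pochhammer symbols -/

/-- The multivariate gamma function of the cone of positive definite Hermitian `m × m` matrices,
`Γ_m(a) = π^(m(m-1)/2) ∏_{r=1}^m Γ(a - r + 1)`. -/
def multiGamma (m : ℕ) (a : ℝ) : ℝ :=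
  Real.pi ^ ((m : ℝ) * ((m : ℝ) - 1) / 2) * ∏ r : Fin m, Real.Gamma (a - (r : ℕ))

/-- The generalized Pochhammer symbol
`(a)_τ = ∏_{r=1}^m Γ(a + τ_r - r + 1) / Γ(a - r + 1)`. -/
def genPochhammer {m : ℕ} (a : ℝ) (τ : Fin m → ℕ) : ℝ :=
  ∏ r : Fin m, Real.Gamma (a + τ r - (r : ℕ)) / Real.Gamma (a - (r : ℕ))

/-! ### The scalar hypergeometric function -/

/-- The `k`-th term `∏ᵢ (aᵢ)_k / ∏ⱼ (eⱼ)_k * z^k / k!` of the scalar hypergeometric series. -/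
def scalarTerm {p q : ℕ} (a : Fin p → ℝ) (e : Fin q → ℝ) (z : ℝ) (k : ℕ) : ℝ :=
  (∏ i, (ascPochhammer ℝ k).eval (a i)) / (∏ j, (ascPochhammer ℝ k).eval (e j)) *
    (z ^ k / (k.factorial : ℝ))

/-- The standard generalized hypergeometric function of a scalar argument. -/
def scalarHyp {p q : ℕ} (a : Fin p → ℝ) (e : Fin q → ℝ) (z : ℝ) : ℝ :=
  ∑' k : ℕ, scalarTerm a e z k

/-! ### Schur functions -/

/-- The Vandermonde determinant `V(x) = ∏_{i < j} (x_i - x_j)`. -/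
def vand {m : ℕ} (x : Fin m → ℝ) : ℝ :=
  ∏ i : Fin m, ∏ j ∈ Finset.Ioi i, (x i - x j)

/-- The exponents `δ = (m - 1, m - 2, …, 0)`. -/
def stair (m : ℕ) : Fin m → ℕ := fun j => m - 1 - (j : ℕ)

/-- The alternant `det (x_i ^ l_j)` as a polynomial in `x_1, …, x_m`. -/
def alternant {m : ℕ} (l : Fin m → ℕ) : MvPolynomial (Fin m) ℝ :=
  (Matrix.of fun i j : Fin m => (MvPolynomial.X i : MvPolynomial (Fin m) ℝ) ^ l j).det

theorem pow_eq_vandermonde_mul {R : Type*} [CommRing R] [Nontrivial R] {m : ℕ}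
    (x : Fin m → R) (l : Fin m → ℕ) :
    ∃ H : Matrix (Fin m) (Fin m) R,
      (Matrix.of fun i j : Fin m => x i ^ l j) = Matrix.vandermonde x * H := by
  classical
  let g : Polynomial R := ∏ i, (Polynomial.X - Polynomial.C (x i))
  have hg : g.Monic := Polynomial.monic_prod_of_monic _ _ fun i _ => Polynomial.monic_X_sub_C _
  have hdeg : g.natDegree = m := by
    simp [g, Polynomial.natDegree_prod_of_monic _ _ fun i _ => Polynomial.monic_X_sub_C (x i)]
  have hroot : ∀ i, g.eval (x i) = 0 := fun i => by
    rw [Polynomial.eval_prod]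
    exact Finset.prod_eq_zero (Finset.mem_univ i) (by simp)
  refine ⟨Matrix.of fun k j => ((Polynomial.X ^ l j) %ₘ g).coeff k, ?_⟩
  ext i j
  have h1 : ((Polynomial.X ^ l j : Polynomial R) %ₘ g).eval (x i) = x i ^ l j := by
    have := congrArg (Polynomial.eval (x i))
      (Polynomial.modByMonic_add_div (Polynomial.X ^ l j : Polynomial R) g)
    simpa [hroot i] using this
  have h2 : ((Polynomial.X ^ l j : Polynomial R) %ₘ g).degree < (m : ℕ) := by
    have := Polynomial.degree_modByMonic_lt (Polynomial.X ^ l j : Polynomial R) hg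
    rwa [Polynomial.degree_eq_natDegree hg.ne_zero, hdeg] at this
  simp only [Matrix.mul_apply, Matrix.of_apply, Matrix.vandermonde_apply]
  rw [← h1, Polynomial.eval_eq_sum, Polynomial.sum_over_range' _ (by simp) m]
  · rw [Finset.sum_range]
    exact Finset.sum_congr rfl fun k _ => mul_comm _ _
  · by_cases h0 : (Polynomial.X ^ l j : Polynomial R) %ₘ g = 0
    · rw [h0] at h2 ⊢
      rcases m with _ | m
      · exact i.elim0
      · simp
    · exact (Polynomial.natDegree_lt_iff_degree_lt h0).2 h2

theorem stair_dvd {m : ℕ} (l : Fin m → ℕ) : alternant (stair m) ∣ alternant l := by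
  obtain ⟨H, hH⟩ := pow_eq_vandermonde_mul
    (MvPolynomial.X : Fin m → MvPolynomial (Fin m) ℝ) l
  have h1 : alternant l = (Matrix.vandermonde
      (MvPolynomial.X : Fin m → MvPolynomial (Fin m) ℝ)).det * H.det := by
    rw [alternant, hH, Matrix.det_mul]
  have h2 : (Matrix.of fun i j : Fin m =>
      (MvPolynomial.X i : MvPolynomial (Fin m) ℝ) ^ stair m j) =
      (Matrix.vandermonde MvPolynomial.X).submatrix id Fin.revPerm := by
    ext1 i j
    simp only [Matrix.of_apply, Matrix.submatrix_apply, Matrix.vandermonde_apply, stair, id,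
      Fin.revPerm_apply, Fin.val_rev]
    congr 1
    omega
  have h3 : alternant (stair m) = ((Equiv.Perm.sign (Fin.revPerm (n := m)) : ℤ) :
      MvPolynomial (Fin m) ℝ) * (Matrix.vandermonde MvPolynomial.X).det := by
    rw [alternant, h2, Matrix.det_permute']
  rw [h1, h3]
  refine Dvd.dvd.mul_right ?_ _
  rcases Int.units_eq_one_or (Equiv.Perm.sign (Fin.revPerm (n := m))) with h | h <;> simp [h]

/-- The Schur polynomial `s_τ = det (x_i ^ (τ_j + m - j)) / det (x_i ^ (m - j))`: the polynomial
quotient of the two alternants. -/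
def schur {m : ℕ} (τ : Fin m → ℕ) : MvPolynomial (Fin m) ℝ :=
  Classical.choose (stair_dvd (τ + stair m))

theorem stair_mul_schur {m : ℕ} (τ : Fin m → ℕ) :
    alternant (stair m) * schur τ = alternant (τ + stair m) :=
  (Classical.choose_spec (stair_dvd (τ + stair m))).symm

/-! ### Zonal polynomials -/

open Classical in
/-- The partitions `τ_1 ≥ τ_2 ≥ … ≥ τ_m ≥ 0` of weight `k` and length at most `m`. -/
def parts (m k : ℕ) : Finset (Fin m → ℕ) :=
  (Finset.piAntidiag Finset.univ k).filter Antitone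

/-- The coefficient of `s_τ` in the expansion of `(x_1 + … + x_m)^|τ|` in Schur polynomials.
It is read off as the coefficient of `x^(τ + δ)` in `(x_1 + … + x_m)^|τ| * det (x_i ^ (m - j))`,
because `x^(τ + δ)` occurs in `s_σ * det (x_i ^ (m - j)) = det (x_i ^ (σ_j + m - j))` with
coefficient `1` if `σ = τ` and `0` for every other partition `σ`
(see `sum_zonal` and `trace_pow_eq_sum_zonal`). -/
def zonalCoeff {m : ℕ} (τ : Fin m → ℕ) : ℝ :=
  MvPolynomial.coeff (Finsupp.equivFunOnFinite.symm (τ + stair m))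
    ((∑ i, MvPolynomial.X i) ^ (∑ i, τ i) * alternant (stair m))

/-- The zonal polynomial `C_τ` as a polynomial in the eigenvalues: the multiple of the Schur
polynomial `s_τ` normalized so that `(x_1 + … + x_m)^k` is the sum of `C_τ` over `|τ| = k`. -/
def zonalPoly {m : ℕ} (τ : Fin m → ℕ) : MvPolynomial (Fin m) ℝ :=
  MvPolynomial.C (zonalCoeff τ) * schur τ

/-- The zonal polynomial `C_τ(X)` of a Hermitian matrix `X`. -/
def zonal {m : ℕ} (τ : Fin m → ℕ) (X : Matrix (Fin m) (Fin m) ℂ) (hX : X.IsHermitian) : ℝ :=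
  MvPolynomial.eval hX.eigenvalues (zonalPoly τ)

theorem alternant_eq {m : ℕ} (l : Fin m → ℕ) :
    alternant l = ∑ σ : Equiv.Perm (Fin m), ((Equiv.Perm.sign σ : ℤ) : ℝ) •
      MvPolynomial.monomial (Finsupp.equivFunOnFinite.symm (l ∘ σ.symm)) (1 : ℝ) := by
  rw [alternant, Matrix.det_apply]
  refine Finset.sum_congr rfl fun σ _ => ?_
  have : ∏ i, (Matrix.of fun i j : Fin m =>
      (MvPolynomial.X i : MvPolynomial (Fin m) ℝ) ^ l j) (σ i) i =
      MvPolynomial.monomial (Finsupp.equivFunOnFinite.symm (l ∘ σ.symm)) (1 : ℝ) := by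
    rw [MvPolynomial.monomial_eq, Finsupp.prod_fintype _ _ (by simp)]
    simp only [Matrix.of_apply, map_one, one_mul]
    rw [← Equiv.prod_comp σ (fun i => (MvPolynomial.X i : MvPolynomial (Fin m) ℝ) ^ _)]
    simp
  rw [this]
  rcases Int.units_eq_one_or (Equiv.Perm.sign σ) with h | h <;> simp [h]

theorem coeff_alternant {m : ℕ} {l d : Fin m → ℕ} (hl : StrictAnti l) (hd : StrictAnti d) :
    (alternant l).coeff (Finsupp.equivFunOnFinite.symm d) = if l = d then 1 else 0 := by
  have key : ∀ σ : Equiv.Perm (Fin m), l ∘ σ.symm = d → σ = 1 := by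
    intro σ h
    have hm : StrictMono σ.symm := fun i j hij => by
      have := hd hij
      rw [← h] at this
      exact hl.lt_iff_gt.1 this
    have : σ.symm = Equiv.refl _ := by
      have := Subsingleton.elim (hm.orderIsoOfSurjective _ σ.symm.surjective) (OrderIso.refl _)
      ext i
      exact congrArg (fun e : Fin m ≃o Fin m => ((e i : Fin m) : ℕ)) this
    exact Equiv.symm_bijective.injective this
  rw [alternant_eq, MvPolynomial.coeff_sum, Finset.sum_eq_single 1]
  · rw [MvPolynomial.coeff_smul, MvPolynomial.coeff_monomial]
    by_cases h : l = d
    · simp [h, Equiv.Perm.one_def]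
    · simp [h, Equiv.Perm.one_def]
  · intro σ _ hσ
    rw [MvPolynomial.coeff_smul, MvPolynomial.coeff_monomial, if_neg, smul_zero]
    exact fun h => hσ (key σ (Finsupp.equivFunOnFinite.symm.injective h))
  · simp

theorem rename_alternant {m : ℕ} (l : Fin m → ℕ) (σ : Equiv.Perm (Fin m)) :
    MvPolynomial.rename σ (alternant l) = ((Equiv.Perm.sign σ : ℤ) : ℝ) • alternant l := by
  have h : (MvPolynomial.rename σ (alternant l) : MvPolynomial (Fin m) ℝ) =
      ((Matrix.of fun i j : Fin m =>
        (MvPolynomial.X i : MvPolynomial (Fin m) ℝ) ^ l j).submatrix σ id).det := by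
    rw [alternant, AlgHom.map_det]
    congr 1
    ext1 i j
    simp
  rw [h, Matrix.det_permute, alternant]
  rcases Int.units_eq_one_or (Equiv.Perm.sign σ) with h | h <;> simp [h]

theorem eq_zero_of_alternating {m : ℕ} (P : MvPolynomial (Fin m) ℝ)
    (hP : ∀ σ : Equiv.Perm (Fin m),
      MvPolynomial.rename σ P = ((Equiv.Perm.sign σ : ℤ) : ℝ) • P)
    (h0 : ∀ d : Fin m → ℕ, StrictAnti d → P.coeff (Finsupp.equivFunOnFinite.symm d) = 0) :
    P = 0 := by
  have hc : ∀ (σ : Equiv.Perm (Fin m)) (d : Fin m → ℕ),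
      P.coeff (Finsupp.equivFunOnFinite.symm (d ∘ σ)) =
        ((Equiv.Perm.sign σ : ℤ) : ℝ) * P.coeff (Finsupp.equivFunOnFinite.symm d) := by
    intro σ d
    have h1 := MvPolynomial.coeff_rename_mapDomain σ σ.injective P
      (Finsupp.equivFunOnFinite.symm (d ∘ σ))
    have h2 : Finsupp.mapDomain σ (Finsupp.equivFunOnFinite.symm (d ∘ σ)) =
        Finsupp.equivFunOnFinite.symm d := by
      ext i
      obtain ⟨j, rfl⟩ := σ.surjective i
      rw [Finsupp.mapDomain_apply σ.injective]
      simp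
    rw [h2, hP, MvPolynomial.coeff_smul, smul_eq_mul] at h1
    exact h1.symm
  ext n
  obtain ⟨d, rfl⟩ := Finsupp.equivFunOnFinite.symm.surjective n
  rw [MvPolynomial.coeff_zero]
  by_cases hd : Function.Injective d
  · have hs : StrictAnti (d ∘ ((Tuple.sort (fun i => OrderDual.toDual (d i))))) := by
      have := (Tuple.monotone_sort (fun i => OrderDual.toDual (d i))).strictMono_of_injective
        ((OrderDual.toDual.injective.comp hd).comp (Equiv.injective _))
      exact fun i j hij => this hij
    have := h0 _ hs
    rw [hc] at this
    rcases Int.units_eq_one_or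
      (Equiv.Perm.sign (Tuple.sort (fun i => OrderDual.toDual (d i)))) with h | h <;>
      simpa [h] using this
  · simp only [Function.Injective, not_forall] at hd
    obtain ⟨i, j, hij, hne⟩ := hd
    have h1 := hc (Equiv.swap i j) d
    have h2 : d ∘ Equiv.swap i j = d := by
      ext r
      simp only [Function.comp, Equiv.swap_apply_def]
      split_ifs with ha hb
      · rw [ha, hij]
      · rw [hb, hij]
      · rfl
    rw [h2, Equiv.Perm.sign_swap hne] at h1
    push_cast at h1
    simp at h1
    linarith

theorem stair_strictAnti (m : ℕ) : StrictAnti (stair m) := by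
  intro i j hij
  have := j.isLt
  have : (i : ℕ) < j := hij
  simp only [stair]
  omega

theorem alternant_stair_ne_zero (m : ℕ) : alternant (stair m) ≠ 0 := by
  intro h
  have := coeff_alternant (stair_strictAnti m) (stair_strictAnti m)
  rw [h] at this
  simp at this

theorem isHomogeneous_alternant {m : ℕ} (l : Fin m → ℕ) :
    (alternant l).IsHomogeneous (∑ i, l i) := by
  rw [alternant_eq]
  refine MvPolynomial.IsHomogeneous.sum _ _ _ fun σ _ => ?_
  rw [MvPolynomial.smul_eq_C_mul]
  refine MvPolynomial.IsHomogeneous.C_mul (MvPolynomial.isHomogeneous_monomial _ ?_) _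
  rw [Finsupp.degree_eq_sum]
  simpa using Equiv.sum_comp σ.symm l

theorem gap_of_strictAnti {m : ℕ} {d : Fin m → ℕ} (hd : StrictAnti d) (n : ℕ) :
    ∀ i j : Fin m, (j : ℕ) = i + n → d j + n ≤ d i := by
  induction n with
  | zero =>
    intro i j h
    rw [show j = i from Fin.ext h]
    simp
  | succ n ih =>
    intro i j h
    have hj := j.isLt
    have h1 := ih i ⟨i + n, by omega⟩ rfl
    have h2 : d j < d ⟨i + n, by omega⟩ := hd (by rw [Fin.lt_def]; simp only; omega)
    omega

/-- The zonal polynomials of weight `k` add up to the `k`-th power of the sum of the variables. -/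
theorem sum_zonal (m k : ℕ) :
    ∑ τ ∈ parts m k, zonalPoly τ =
      ((∑ i, MvPolynomial.X i) ^ k : MvPolynomial (Fin m) ℝ) := by
  refine mul_left_cancel₀ (alternant_stair_ne_zero m) (sub_eq_zero.1 ?_)
  have hL : alternant (stair m) * ∑ τ ∈ parts m k, zonalPoly τ =
      ∑ τ ∈ parts m k, zonalCoeff τ • alternant (τ + stair m) := by
    rw [Finset.mul_sum]
    refine Finset.sum_congr rfl fun τ _ => ?_
    rw [zonalPoly, MvPolynomial.smul_eq_C_mul, ← stair_mul_schur]
    ring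
  rw [hL]
  refine eq_zero_of_alternating _ (fun σ => ?_) (fun d hd => ?_)
  · simp only [map_sub, map_sum, map_mul, map_pow, map_smul, rename_alternant,
      MvPolynomial.rename_X]
    rw [Equiv.sum_comp σ (fun i => (MvPolynomial.X i : MvPolynomial (Fin m) ℝ)), smul_sub,
      Finset.smul_sum, smul_mul_assoc]
    congr 1
    exact Finset.sum_congr rfl fun τ _ => smul_comm _ _ _
  · have hadd : ∀ τ ∈ parts m k, StrictAnti (τ + stair m) := fun τ hτ =>
      (Finset.mem_filter.1 hτ).2.add_strictAnti (stair_strictAnti m)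
    rw [MvPolynomial.coeff_sub, MvPolynomial.coeff_sum, sub_eq_zero]
    simp only [MvPolynomial.coeff_smul]
    rw [Finset.sum_congr rfl fun τ hτ => by rw [coeff_alternant (hadd τ hτ) hd]]
    by_cases hw : ∑ i, d i = k + ∑ i, stair m i
    · have hle : stair m ≤ d := fun i => by
        have hi := i.isLt
        have := gap_of_strictAnti hd (m - 1 - i) i ⟨m - 1, by omega⟩ (by simp only; omega)
        simp only [stair]
        omega
      have hdτ : (d - stair m) + stair m = d := tsub_add_cancel_of_le hle
      have hmem : d - stair m ∈ parts m k := by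
        refine Finset.mem_filter.2 ⟨?_, fun i j hij => ?_⟩
        · have h1 : ∑ i, (d - stair m) i + ∑ i, stair m i = ∑ i, d i := by
            rw [← Finset.sum_add_distrib]
            exact Finset.sum_congr rfl fun i _ => congrFun hdτ i
          exact Finset.mem_piAntidiag.2 ⟨add_right_cancel (h1.trans hw), by simp⟩
        · have hj := j.isLt
          have hij' : (i : ℕ) ≤ j := hij
          have h1 := gap_of_strictAnti hd (j - i) i j (by omega)
          have h2 := hle i
          have h3 := hle j
          simp only [Pi.sub_apply, stair] at h2 h3 ⊢
          omega
      rw [Finset.sum_eq_single (d - stair m)]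
      · rw [if_pos hdτ, smul_eq_mul, mul_one, zonalCoeff, hdτ]
        have : ∑ i, (d - stair m) i = k := by
          have := (Finset.mem_filter.1 hmem).1
          simpa using this
        rw [this, mul_comm]
      · intro τ _ hne
        rw [if_neg, smul_zero]
        rintro rfl
        exact hne (by simp)
      · exact fun h => absurd hmem h
    · rw [Finset.sum_eq_zero]
      · symm
        have hom : (alternant (stair m) * (∑ i, MvPolynomial.X i) ^ k).IsHomogeneous
            (∑ i, stair m i + 1 * k) :=
          (isHomogeneous_alternant _).mul
            ((MvPolynomial.IsHomogeneous.sum _ _ _ fun i _ =>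
              MvPolynomial.isHomogeneous_X _ i).pow k)
        refine hom.coeff_eq_zero ?_
        rw [Finsupp.degree_eq_sum]
        simp only [Finsupp.equivFunOnFinite_symm_apply_apply]
        omega
      · intro τ hτ
        rw [if_neg, smul_zero]
        rintro rfl
        apply hw
        have := (Finset.mem_filter.1 hτ).1
        simp at this
        simp [Finset.sum_add_distrib, this]

/-- The normalization of the zonal polynomials: `(tr X)^k` is the sum of `C_τ(X)` over the
partitions `τ` of `k`. -/
theorem trace_pow_eq_sum_zonal {m : ℕ} (k : ℕ) (X : Matrix (Fin m) (Fin m) ℂ)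
    (hX : X.IsHermitian) :
    X.trace ^ k = ((∑ τ ∈ parts m k, zonal τ X hX : ℝ) : ℂ) := by
  simp only [zonal]
  rw [← map_sum, sum_zonal, hX.trace_eq_sum_eigenvalues]
  simp

/-! ### The hypergeometric function of two matrix arguments -/

/-- The term of weight `k`, `∑_{|τ| = k} ∏ᵢ (aᵢ)_τ C_τ(B) C_τ(C) / (∏ⱼ (eⱼ)_τ C_τ(I) k!)`, of the
hypergeometric series of two Hermitian matrix arguments. -/
def matrixTerm {m p q : ℕ} (a : Fin p → ℝ) (e : Fin q → ℝ)
    (B C : Matrix (Fin m) (Fin m) ℂ) (hB : B.IsHermitian) (hC : C.IsHermitian) (k : ℕ) : ℝ :=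
  ∑ τ ∈ parts m k,
    ((∏ i, genPochhammer (a i) τ) * zonal τ B hB * zonal τ C hC) /
      ((∏ j, genPochhammer (e j) τ) * zonal τ 1 Matrix.isHermitian_one * (k.factorial : ℝ))

/-- The hypergeometric function of two Hermitian matrix arguments. -/
def matrixHyp {m p q : ℕ} (a : Fin p → ℝ) (e : Fin q → ℝ)
    (B C : Matrix (Fin m) (Fin m) ℂ) (hB : B.IsHermitian) (hC : C.IsHermitian) : ℝ :=
  ∑' k : ℕ, matrixTerm a e B C hB hC k

/-- The determinantal side
`π^(m(m-1)/2 (p-q-1)) Γ_m(m) ∏ᵢ Γ(μᵢ+1)^m / Γ_m(m+μᵢ) ∏ⱼ Γ_m(m+φⱼ) / Γ(φⱼ+1)^m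
  * det(pFq((μᵢ+1), (1+φⱼ); x_l y_f)) / (V(x) V(y))`,
a function of two vectors with pairwise distinct coordinates. -/
def detSide {m p q : ℕ} (μ : Fin p → ℝ) (φ : Fin q → ℝ) (x y : Fin m → ℝ) : ℝ :=
  Real.pi ^ ((m : ℝ) * ((m : ℝ) - 1) / 2 * ((p : ℝ) - (q : ℝ) - 1)) * multiGamma m m *
    (∏ i, Real.Gamma (μ i + 1) ^ m / multiGamma m ((m : ℝ) + μ i)) *
    (∏ j, multiGamma m ((m : ℝ) + φ j) / Real.Gamma (φ j + 1) ^ m) *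
    ((Matrix.of fun l f : Fin m =>
        scalarHyp (fun i => μ i + 1) (fun j => 1 + φ j) (x l * y f)).det /
      (vand x * vand y))

end

end HermitianHypergeometric

namespace HermitianHypergeometric

/-! ### Symmetry of the Schur polynomials -/

/-! Let `w k` be the coefficient of `z ^ k` in the scalar series, so the determinant on the right
has entries `∑ w k * x_l ^ k * y_f ^ k`. Newton interpolation at the nodes `x` writes every power as
`x_l ^ k = ∑ N_{l,i}(x) D_{k,i}(x)`, where the `D_{k,i}` are divided differences. The matrix of
scalar values is thus `N(x) * M * N(y)ᵀ`, with `M = dividedMatrix`. Since `det N(x)` is the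
Vandermonde determinant, the quotient by `V(x) V(y)` is `det M`, which is defined and continuous
also at repeated coordinates.

Cauchy–Binet for infinite sums expands `det M` over strictly decreasing exponents `τ + δ`. The
minors of `D` in these rows are the Schur polynomials up to a common sign, which squares to one.
Hence `det M = ∑ (∏ w(τ_r + δ_r)) s_τ(x) s_τ(y)` over partitions `τ`.

It remains to match coefficients. The formula `zonalCoeff_eq`, in effect `C_τ = k! s_τ(1) ∏ δ_r! / ∏
(τ_r + δ_r)! * s_τ`, turns `C_τ(B) C_τ(C) / (C_τ(I) k!)` into `s_τ(b) s_τ(c) ∏ δ_r! / ∏ (τ_r +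
δ_r)!`. By `genPochhammer_eq`, `(m + ν)_τ` is a constant times `∏ (ν + 1)_{τ_r + δ_r}`. The
constants combine to the stated prefactor, and continuity of `det M` gives the limit at repeated
eigenvalues. -/

/-- Both alternants in the quotient change by the sign of the permutation. -/
theorem eval_schur_comp_perm {m : ℕ} (τ : Fin m → ℕ) (σ : Equiv.Perm (Fin m)) (x : Fin m → ℝ) :
    MvPolynomial.eval (x ∘ σ) (schur τ) = MvPolynomial.eval x (schur τ) := by
  rw [← MvPolynomial.eval_rename]
  congr 1
  refine mul_left_cancel₀ (alternant_stair_ne_zero m) ?_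
  have h := congrArg (MvPolynomial.rename σ) (stair_mul_schur τ)
  rw [map_mul, rename_alternant, rename_alternant, ← stair_mul_schur τ, smul_mul_assoc] at h
  rcases Int.units_eq_one_or (Equiv.Perm.sign σ) with hσ | hσ <;> simpa [hσ] using h

/-- Both families list the roots of the same polynomial, so they agree after sorting. -/
theorem exists_perm_of_charpoly_eq {m : ℕ} {B : Matrix (Fin m) (Fin m) ℂ} (hB : B.IsHermitian)
    {b : Fin m → ℝ} (hb : B.charpoly = ∏ l, (Polynomial.X - Polynomial.C (b l : ℂ))) :
    ∃ σ : Equiv.Perm (Fin m), hB.eigenvalues = b ∘ σ := by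
  have h : Multiset.map (fun i => (hB.eigenvalues i : ℂ)) Finset.univ.val =
      Multiset.map (fun i => (b i : ℂ)) Finset.univ.val := by
    have h1 : ∀ v : Fin m → ℂ, (∏ l, (Polynomial.X - Polynomial.C (v l))).roots =
        Multiset.map v Finset.univ.val := fun v => by
      have := Polynomial.roots_multiset_prod_X_sub_C (Multiset.map v Finset.univ.val)
      rw [Multiset.map_map] at this
      exact this
    rw [← h1, ← h1, ← hb]
    exact congrArg _ hB.charpoly_eq.symm
  have h2 : List.Perm (List.ofFn hB.eigenvalues) (List.ofFn b) := by
    have h3 := congrArg (Multiset.map Complex.re) h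
    simp only [Multiset.map_map, Function.comp_def, Complex.ofReal_re] at h3
    rw [Fin.univ_val_map, Fin.univ_val_map] at h3
    exact Multiset.coe_eq_coe.1 h3
  have h4 : hB.eigenvalues ∘ Tuple.sort hB.eigenvalues = b ∘ Tuple.sort b :=
    List.ofFn_injective <|
      ((((Tuple.sort hB.eigenvalues).ofFn_comp_perm _).trans h2).trans
        ((Tuple.sort b).ofFn_comp_perm b).symm).eq_of_pairwise'
        (Tuple.monotone_sort _).sortedLE_ofFn.pairwise (Tuple.monotone_sort _).sortedLE_ofFn.pairwise
  refine ⟨(Tuple.sort hB.eigenvalues).symm.trans (Tuple.sort b), funext fun i => ?_⟩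
  simpa using congrFun h4 ((Tuple.sort hB.eigenvalues).symm i)

theorem zonal_eq {m : ℕ} (τ : Fin m → ℕ) {B : Matrix (Fin m) (Fin m) ℂ} (hB : B.IsHermitian)
    {b : Fin m → ℝ} (hb : B.charpoly = ∏ l, (Polynomial.X - Polynomial.C (b l : ℂ))) :
    zonal τ B hB = zonalCoeff τ * MvPolynomial.eval b (schur τ) := by
  obtain ⟨σ, hσ⟩ := exists_perm_of_charpoly_eq hB hb
  rw [zonal, hσ, zonalPoly, map_mul, MvPolynomial.eval_C, eval_schur_comp_perm]

/-! ### Newton interpolation of powers -/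

/-- The divided difference of `t ^ l` at `x 0, …, x k`, that is, the complete homogeneous symmetric
polynomial of degree `l - k` in `x 0, …, x k`. -/
def newtonCoeff {R : Type*} [CommRing R] (x : ℕ → R) : ℕ → ℕ → R
  | 0, 0 => 1
  | 0, _ + 1 => 0
  | l + 1, 0 => x 0 * newtonCoeff x l 0
  | l + 1, k + 1 => x (k + 1) * newtonCoeff x l (k + 1) + newtonCoeff x l k

/-- Induction on `l`: multiply the `k`-th term by `t = x k + (t - x k)`. The product that overflows
the basis is the full product over the nodes, which vanishes by `ht`. -/
theorem pow_eq_sum_newtonCoeff {R : Type*} [CommRing R] (x : ℕ → R) {n : ℕ} (t : R)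
    (hn : 0 < n) (ht : ∏ j ∈ Finset.range n, (t - x j) = 0) (l : ℕ) :
    t ^ l = ∑ k ∈ Finset.range n, (∏ j ∈ Finset.range k, (t - x j)) * newtonCoeff x l k := by
  obtain ⟨n, rfl⟩ := Nat.exists_eq_succ_of_ne_zero hn.ne'
  induction l with
  | zero => simp [Finset.sum_range_succ', newtonCoeff]
  | succ l ih =>
    have h1 : ∑ k ∈ Finset.range (n + 1),
        (∏ j ∈ Finset.range k, (t - x j)) * newtonCoeff x (l + 1) k =
        ∑ k ∈ Finset.range (n + 1), (∏ j ∈ Finset.range k, (t - x j)) * (x k * newtonCoeff x l k) +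
        ∑ k ∈ Finset.range n, (∏ j ∈ Finset.range (k + 1), (t - x j)) * newtonCoeff x l k := by
      rw [Finset.sum_range_succ', Finset.sum_range_succ' (fun k => _ * (x k * newtonCoeff x l k))]
      simp only [newtonCoeff, mul_add, Finset.sum_add_distrib]
      ring
    have h2 : ∑ k ∈ Finset.range n, (∏ j ∈ Finset.range (k + 1), (t - x j)) * newtonCoeff x l k =
        ∑ k ∈ Finset.range (n + 1),
          (∏ j ∈ Finset.range (k + 1), (t - x j)) * newtonCoeff x l k := by
      rw [Finset.sum_range_succ _ n, ht, zero_mul, add_zero]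
    rw [h1, h2, ← Finset.sum_add_distrib, pow_succ, ih, Finset.sum_mul]
    refine Finset.sum_congr rfl fun k _ => ?_
    rw [Finset.prod_range_succ]
    ring

theorem newtonCoeff_of_lt {R : Type*} [CommRing R] (x : ℕ → R) :
    ∀ {l k : ℕ}, l < k → newtonCoeff x l k = 0
  | 0, _ + 1, _ => rfl
  | l + 1, k + 1, h => by
    rw [newtonCoeff, newtonCoeff_of_lt x (by omega), newtonCoeff_of_lt x (by omega)]
    simp

theorem newtonCoeff_self {R : Type*} [CommRing R] (x : ℕ → R) (l : ℕ) :
    newtonCoeff x l l = 1 := by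
  induction l with
  | zero => rfl
  | succ l ih => rw [newtonCoeff, newtonCoeff_of_lt x (by omega), ih]; simp

theorem map_newtonCoeff {R S : Type*} [CommRing R] [CommRing S] (f : R →+* S) (x : ℕ → R)
    (l k : ℕ) : f (newtonCoeff x l k) = newtonCoeff (fun i => f (x i)) l k := by
  induction l generalizing k with
  | zero => cases k <;> simp [newtonCoeff]
  | succ l ih => cases k <;> simp [newtonCoeff, ih]

/-- The gap `s - r` absorbs the growth in `l`: with `A = (s - r)⁻¹`, the recursion closes because `r
* A + 1 = s * A`. -/
theorem abs_newtonCoeff_le {x : ℕ → ℝ} {r s : ℝ} (hx : ∀ i, |x i| ≤ r) (hrs : r < s) (l k : ℕ) :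
    |newtonCoeff x l k| ≤ (s - r)⁻¹ ^ k * s ^ l := by
  have hr : 0 ≤ r := (abs_nonneg _).trans (hx 0)
  have hA : 0 < s - r := sub_pos.2 hrs
  have hs : 0 < s := hr.trans_lt hrs
  induction l generalizing k with
  | zero =>
    cases k with
    | zero => simp [newtonCoeff]
    | succ k => simp only [newtonCoeff, abs_zero]; positivity
  | succ l ih =>
    cases k with
    | zero =>
      have := ih 0
      simp only [pow_zero, one_mul] at this ⊢
      rw [newtonCoeff, abs_mul, pow_succ, mul_comm (s ^ l)]
      exact mul_le_mul ((hx 0).trans hrs.le) this (abs_nonneg _) hs.le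
    | succ k =>
      rw [newtonCoeff]
      refine (abs_add_le _ _).trans ?_
      rw [abs_mul]
      calc |x (k + 1)| * |newtonCoeff x l (k + 1)| + |newtonCoeff x l k|
          ≤ r * ((s - r)⁻¹ ^ (k + 1) * s ^ l) + (s - r)⁻¹ ^ k * s ^ l :=
            add_le_add (mul_le_mul (hx _) (ih _) (abs_nonneg _) hr) (ih _)
        _ = (s - r)⁻¹ ^ (k + 1) * s ^ (l + 1) := by
            rw [pow_succ, pow_succ]
            linear_combination (s - r)⁻¹ ^ k * s ^ l * (mul_inv_cancel₀ hA.ne').symm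

theorem continuous_newtonCoeff {X : Type*} [TopologicalSpace X] {f : ℕ → X → ℝ}
    (hf : ∀ i, Continuous (f i)) (l k : ℕ) :
    Continuous fun z => newtonCoeff (fun i => f i z) l k := by
  induction l generalizing k with
  | zero => cases k <;> simpa only [newtonCoeff] using continuous_const
  | succ l ih =>
    cases k with
    | zero => exact (hf 0).mul (ih 0)
    | succ k => exact ((hf _).mul (ih _)).add (ih _)

/-- A finite family continued by zero. -/
def extendZero {R : Type*} [Zero R] {m : ℕ} (x : Fin m → R) (i : ℕ) : R :=
  if h : i < m then x ⟨i, h⟩ else 0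

theorem extendZero_val {R : Type*} [Zero R] {m : ℕ} (x : Fin m → R) (i : Fin m) :
    extendZero x i = x i := by
  simp [extendZero]

theorem map_extendZero {R S : Type*} [CommRing R] [CommRing S] (f : R →+* S) {m : ℕ}
    (x : Fin m → R) (i : ℕ) : f (extendZero x i) = extendZero (fun i => f (x i)) i := by
  unfold extendZero
  split_ifs <;> simp

theorem abs_extendZero_le {m : ℕ} {x : Fin m → ℝ} {r : ℝ} (hr : 0 ≤ r) (hx : ∀ i, |x i| ≤ r)
    (i : ℕ) : |extendZero x i| ≤ r := by
  unfold extendZero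
  split_ifs
  · exact hx _
  · simpa using hr

theorem continuous_extendZero {m : ℕ} (i : ℕ) :
    Continuous fun x : Fin m → ℝ => extendZero x i := by
  unfold extendZero
  split_ifs
  · exact continuous_apply _
  · exact continuous_const

/-- The values at the `x i` of the Newton basis polynomials with nodes `x 0, x 1, …`. -/
def newtonBasis {R : Type*} [CommRing R] {m : ℕ} (x : Fin m → R) : Matrix (Fin m) (Fin m) R :=
  Matrix.of fun i k => ∏ j ∈ Finset.range k, (x i - extendZero x j)

theorem pow_eq_sum_newtonBasis {R : Type*} [CommRing R] {m : ℕ} (x : Fin m → R) (i : Fin m)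
    (l : ℕ) : x i ^ l = ∑ k, newtonBasis x i k * newtonCoeff (extendZero x) l k := by
  rw [pow_eq_sum_newtonCoeff (extendZero x) (x i) i.pos ?_ l, Finset.sum_range]
  · rfl
  · refine Finset.prod_eq_zero (Finset.mem_range.2 i.isLt) ?_
    rw [extendZero_val, sub_self]

theorem of_pow_eq_newtonBasis_mul {R : Type*} [CommRing R] {m : ℕ} (x : Fin m → R)
    (l : Fin m → ℕ) :
    (Matrix.of fun i j => x i ^ l j) =
      newtonBasis x * Matrix.of fun k j : Fin m => newtonCoeff (extendZero x) (l j) k := by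
  ext i j
  simp [Matrix.mul_apply, ← pow_eq_sum_newtonBasis]

/-- Monomials and the Newton basis differ by a unitriangular matrix. -/
theorem det_newtonBasis {R : Type*} [CommRing R] {m : ℕ} (x : Fin m → R) :
    (newtonBasis x).det = (Matrix.vandermonde x).det := by
  have h : Matrix.vandermonde x = newtonBasis x * Matrix.of fun k j : Fin m =>
      newtonCoeff (extendZero x) j k := of_pow_eq_newtonBasis_mul x (fun j => (j : ℕ))
  have h1 : (Matrix.of fun k j : Fin m => newtonCoeff (extendZero x) j k).det = 1 := by
    rw [Matrix.det_of_isUpperTriangular]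
    · simp [newtonCoeff_self]
    · intro i j hij
      exact newtonCoeff_of_lt _ hij
  rw [h, Matrix.det_mul, h1, mul_one]

theorem vand_eq {m : ℕ} (x : Fin m → ℝ) :
    vand x = (∏ i : Fin m, ∏ _j ∈ Finset.Ioi i, (-1)) * (Matrix.vandermonde x).det := by
  rw [Matrix.det_vandermonde, vand, ← Finset.prod_mul_distrib]
  refine Finset.prod_congr rfl fun i _ => ?_
  rw [← Finset.prod_mul_distrib]
  exact Finset.prod_congr rfl fun j _ => by ring

theorem vand_mul_vand {m : ℕ} (x y : Fin m → ℝ) :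
    vand x * vand y = (Matrix.vandermonde x).det * (Matrix.vandermonde y).det := by
  have h : (∏ i : Fin m, ∏ _j ∈ Finset.Ioi i, (-1 : ℝ)) *
      (∏ i : Fin m, ∏ _j ∈ Finset.Ioi i, (-1 : ℝ)) = 1 := by
    simp only [← Finset.prod_mul_distrib]
    simp
  rw [vand_eq, vand_eq, mul_mul_mul_comm, h, one_mul]

theorem det_pow_stair {R : Type*} [CommRing R] {m : ℕ} (x : Fin m → R) :
    (Matrix.of fun i j : Fin m => x i ^ stair m j).det =
      ((Equiv.Perm.sign (Fin.revPerm (n := m)) : ℤ) : R) * (Matrix.vandermonde x).det := by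
  rw [← Matrix.det_permute']
  congr 1
  ext1 i j
  simp only [Matrix.of_apply, Matrix.submatrix_apply, Matrix.vandermonde_apply, stair, id,
    Fin.revPerm_apply, Fin.val_rev]
  congr 1
  omega

/-- The Vandermonde factor is cancelled in the polynomial ring, before evaluation, so coinciding
coordinates are allowed. The sign comes from `δ` listing the exponents in decreasing order. -/
theorem eval_schur {m : ℕ} (τ : Fin m → ℕ) (x : Fin m → ℝ) :
    MvPolynomial.eval x (schur τ) = ((Equiv.Perm.sign (Fin.revPerm (n := m)) : ℤ) : ℝ) *
      (Matrix.of fun r k : Fin m =>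
        newtonCoeff (extendZero x) ((τ + stair m) r) k).det := by
  set ε : ℤ := (Equiv.Perm.sign (Fin.revPerm (n := m)) : ℤ) with hε
  have hε2 : (ε : MvPolynomial (Fin m) ℝ) * ε = 1 := by
    rcases Int.units_eq_one_or (Equiv.Perm.sign (Fin.revPerm (n := m))) with h | h <;>
      simp [hε, h]
  have h : schur τ = (ε : MvPolynomial (Fin m) ℝ) * (Matrix.of fun k j : Fin m =>
      newtonCoeff (extendZero (MvPolynomial.X : Fin m → MvPolynomial (Fin m) ℝ))
        ((τ + stair m) j) k).det := by
    refine mul_left_cancel₀ (alternant_stair_ne_zero m) ?_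
    rw [stair_mul_schur, alternant, of_pow_eq_newtonBasis_mul, Matrix.det_mul, det_newtonBasis,
      alternant, det_pow_stair, ← hε]
    generalize (Matrix.of fun k j : Fin m => newtonCoeff (extendZero
      (MvPolynomial.X : Fin m → MvPolynomial (Fin m) ℝ)) ((τ + stair m) j) k).det = d
    linear_combination (-(Matrix.vandermonde
      (MvPolynomial.X : Fin m → MvPolynomial (Fin m) ℝ)).det * d) * hε2
  rw [h, map_mul, map_intCast, RingHom.map_det, ← Matrix.det_transpose]
  congr 2
  ext r k
  simp [map_newtonCoeff, map_extendZero]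

/-! ### Schur polynomials at `(1, …, 1)` and the normalization of the zonal polynomials -/

/-- Principal specialization: at `x_i = X ^ i` both alternants become Vandermonde determinants in
the powers `X ^ l_j`; then `X` is set to `1`. -/
theorem eval_one_schur_mul {m : ℕ} (τ : Fin m → ℕ) :
    MvPolynomial.eval 1 (schur τ) * (Matrix.vandermonde fun i => (stair m i : ℝ)).det =
      (Matrix.vandermonde fun i => ((τ + stair m) i : ℝ)).det := by
  let G : ℕ → Polynomial ℝ := fun a => ∑ k ∈ Finset.range a, Polynomial.X ^ k
  have hG : ∀ l : Fin m → ℕ, MvPolynomial.aeval (fun i : Fin m => (Polynomial.X ^ (i : ℕ) :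
      Polynomial ℝ)) (alternant l) = (∏ i : Fin m, ∏ _j ∈ Finset.Ioi i, (Polynomial.X - 1)) *
      (Matrix.vandermonde fun i => G (l i)).det := by
    intro l
    have h1 : MvPolynomial.aeval (fun i : Fin m => (Polynomial.X ^ (i : ℕ) : Polynomial ℝ))
        (alternant l) = (Matrix.vandermonde fun i => (Polynomial.X ^ l i : Polynomial ℝ)).det := by
      rw [alternant, AlgHom.map_det, ← Matrix.det_transpose]
      congr 1
      ext1 i j
      simp [Matrix.vandermonde_apply, ← pow_mul, mul_comm]
    rw [h1, Matrix.det_vandermonde, Matrix.det_vandermonde, ← Finset.prod_mul_distrib]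
    refine Finset.prod_congr rfl fun i _ => ?_
    rw [← Finset.prod_mul_distrib]
    refine Finset.prod_congr rfl fun j _ => ?_
    have h2 := fun a => geom_sum_mul (Polynomial.X : Polynomial ℝ) a
    linear_combination h2 (l i) - h2 (l j)
  have h := congrArg (MvPolynomial.aeval (fun i : Fin m => (Polynomial.X ^ (i : ℕ) :
    Polynomial ℝ))) (stair_mul_schur τ)
  rw [map_mul, hG, hG, mul_assoc] at h
  -- The common power of `X - 1` must be cancelled before evaluating at `1`, where it may vanish.
  have h0 : (∏ i : Fin m, ∏ _j ∈ Finset.Ioi i, (Polynomial.X - 1 : Polynomial ℝ)) ≠ 0 :=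
    Finset.prod_ne_zero_iff.2 fun _ _ => Finset.prod_ne_zero_iff.2 fun _ _ =>
      Polynomial.X_sub_C_ne_zero 1
  have h1 := congrArg (Polynomial.evalRingHom 1) (mul_left_cancel₀ h0 h)
  have hV : ∀ l : Fin m → ℕ, Polynomial.evalRingHom 1 (Matrix.vandermonde fun i => G (l i)).det =
      (Matrix.vandermonde fun i => (l i : ℝ)).det := fun l => by
    rw [RingHom.map_det]
    congr 1
    ext1 i j
    simp [G, Matrix.vandermonde_apply, Polynomial.eval_finsetSum]
  have hs : Polynomial.evalRingHom 1 (MvPolynomial.aeval (fun i : Fin m => (Polynomial.X ^ (i : ℕ) :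
      Polynomial ℝ)) (schur τ)) = MvPolynomial.eval 1 (schur τ) := by
    rw [MvPolynomial.aeval_def, MvPolynomial.hom_eval₂, MvPolynomial.eval, MvPolynomial.eval₂Hom]
    simp only [RingHom.coe_mk]
    congr 1
    · ext; simp
    · ext; simp
  rw [map_mul, hV, hV, hs] at h1
  rw [mul_comm]
  exact h1

/-- Falling factorials are monic polynomials of consecutive degrees. -/
theorem det_descFactorial_stair {m : ℕ} (l : Fin m → ℕ) :
    (Matrix.of fun i j : Fin m => ((l i).descFactorial (stair m j) : ℝ)).det =
      ((Equiv.Perm.sign (Fin.revPerm (n := m)) : ℤ) : ℝ) *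
        (Matrix.vandermonde fun i => (l i : ℝ)).det := by
  rw [Matrix.det_eval_matrixOfPolynomials_eq_det_vandermonde (fun i => (l i : ℝ))
    (fun i => descPochhammer ℝ i) (fun i => descPochhammer_natDegree ℝ i)
    (fun i => monic_descPochhammer ℝ i), ← Matrix.det_permute']
  congr 1
  ext1 i j
  simp only [Matrix.of_apply, Matrix.submatrix_apply, stair, id, Fin.revPerm_apply, Fin.val_rev,
    descPochhammer_eval_eq_descFactorial]
  congr 2
  omega

theorem coeff_sum_X_pow_mul_prod_factorial {m : ℕ} (d : Fin m →₀ ℕ) {n : ℕ}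
    (hd : ∑ i, d i = n) :
    MvPolynomial.coeff d ((∑ i, MvPolynomial.X i : MvPolynomial (Fin m) ℝ) ^ n) *
      ∏ i, ((d i).factorial : ℝ) = (n.factorial : ℝ) := by
  rw [MvPolynomial.coeff_sum_X_pow_of_fintype, if_pos,
    Finsupp.multinomial_eq_of_support_subset (Finset.subset_univ d.support), ← hd,
    ← Nat.multinomial_spec, mul_comm]
  · push_cast
    rfl
  · rw [Finsupp.sum_fintype _ _ (by simp), hd]

/-- Expanding the alternant over `σ` leaves multinomial coefficients `k! / ∏ (l_i - δ_{σ⁻¹ i})!`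
with `l = τ + δ`; multiplying by `∏ l_i!` makes them falling factorials. -/
theorem zonalCoeff_mul_prod_factorial {m : ℕ} (τ : Fin m → ℕ) :
    zonalCoeff τ * ∏ i, (((τ + stair m) i).factorial : ℝ) = ((∑ i, τ i).factorial : ℝ) *
      (Matrix.of fun i j : Fin m => (((τ + stair m) i).descFactorial (stair m j) : ℝ)).det := by
  rw [zonalCoeff, alternant_eq, Finset.mul_sum, MvPolynomial.coeff_sum, Finset.sum_mul,
    Matrix.det_apply', Finset.mul_sum]
  refine Finset.sum_congr rfl fun σ _ => ?_
  rw [mul_smul_comm, MvPolynomial.coeff_smul, MvPolynomial.coeff_mul_monomial', smul_eq_mul,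
    mul_assoc, mul_left_comm ((∑ i, τ i).factorial : ℝ)]
  refine congrArg _ ?_
  change _ = ((∑ i, τ i).factorial : ℝ) *
    ∏ i, (((τ + stair m) (σ i)).descFactorial (stair m i) : ℝ)
  rw [← Equiv.prod_comp σ.symm (fun i =>
    (((τ + stair m) (σ i)).descFactorial (stair m i) : ℝ))]
  simp only [Equiv.apply_symm_apply]
  split_ifs with h
  · have hle : ∀ i, stair m (σ.symm i) ≤ (τ + stair m) i := h
    have hsum : ∑ i, (Finsupp.equivFunOnFinite.symm (τ + stair m) -
        Finsupp.equivFunOnFinite.symm (stair m ∘ σ.symm)) i = ∑ i, τ i := by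
      have h1 : ∑ i, ((τ + stair m) i - stair m (σ.symm i)) + ∑ i, stair m (σ.symm i) =
          ∑ i, (τ + stair m) i := by
        rw [← Finset.sum_add_distrib]
        exact Finset.sum_congr rfl fun i _ => Nat.sub_add_cancel (hle i)
      rw [Equiv.sum_comp σ.symm (stair m)] at h1
      simp only [Pi.add_apply, Finset.sum_add_distrib] at h1
      simpa using add_right_cancel h1
    rw [← coeff_sum_X_pow_mul_prod_factorial _ hsum, mul_one, mul_assoc,
      ← Finset.prod_mul_distrib]
    refine congrArg _ ?_
    refine Finset.prod_congr rfl fun i _ => ?_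
    exact_mod_cast (Nat.factorial_mul_descFactorial (hle i)).symm
  -- If the monomial does not divide, the coefficient is zero and so is a falling factorial.
  · obtain ⟨i, hi⟩ : ∃ i, (τ + stair m) i < stair m (σ.symm i) := by
      by_contra! hc
      exact h hc
    have h0 : ∏ i, (((τ + stair m) i).descFactorial (stair m (σ.symm i)) : ℝ) = 0 :=
      Finset.prod_eq_zero (Finset.mem_univ i) (by
        exact_mod_cast Nat.descFactorial_eq_zero_iff_lt.2 hi)
    rw [h0, zero_mul, mul_zero]

theorem zonalCoeff_eq {m : ℕ} (τ : Fin m → ℕ) :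
    zonalCoeff τ * ∏ i, (((τ + stair m) i).factorial : ℝ) = ((∑ i, τ i).factorial : ℝ) *
      MvPolynomial.eval 1 (schur τ) * ∏ i, ((stair m i).factorial : ℝ) := by
  -- The case `τ = 0` identifies the signed Vandermonde determinant of `δ` with `∏ δ_r!`.
  have h0 : zonalCoeff (0 : Fin m → ℕ) = 1 := by
    simp [zonalCoeff, coeff_alternant (stair_strictAnti m) (stair_strictAnti m)]
  have h1 := zonalCoeff_mul_prod_factorial (0 : Fin m → ℕ)
  have h2 := zonalCoeff_mul_prod_factorial τ
  rw [det_descFactorial_stair] at h1 h2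
  rw [h0] at h1
  simp only [zero_add, one_mul, Pi.zero_apply, Finset.sum_const_zero, Nat.factorial_zero,
    Nat.cast_one] at h1
  rw [h2, h1, ← eval_one_schur_mul]
  ring

theorem eval_one_schur_ne_zero {m : ℕ} {τ : Fin m → ℕ} (hτ : Antitone τ) :
    MvPolynomial.eval 1 (schur τ) ≠ 0 := by
  intro h
  have h1 := eval_one_schur_mul τ
  rw [h, zero_mul] at h1
  refine Matrix.det_vandermonde_ne_zero_iff.2 ?_ h1.symm
  exact Nat.cast_injective.comp (hτ.add_strictAnti (stair_strictAnti m)).injective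

/-! ### The Cauchy–Binet formula for infinite sums -/

theorem hasSum_mul_prod {α β : Type*} {f : α → ℝ} {g : β → ℝ} {s t : ℝ}
    (hf : HasSum f s) (hg : HasSum g t) :
    HasSum (fun z : α × β => f z.1 * g z.2) (s * t) :=
  hf.mul hg (summable_mul_of_summable_norm hf.summable.norm hg.summable.norm)

theorem hasSum_prod_pi {m : ℕ} (f : Fin m → ℕ → ℝ) (hf : ∀ i, Summable (f i)) :
    HasSum (fun l : Fin m → ℕ => ∏ i, f i (l i)) (∏ i, ∑' k, f i k) := by
  induction m with
  | zero => simp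
  | succ m ih =>
    have h := hasSum_mul_prod (hf 0).hasSum (ih (fun i => f i.succ) fun i => hf _)
    rw [Fin.prod_univ_succ, ← (Fin.consEquiv fun _ => ℕ).hasSum_iff]
    have h3 : (fun l : Fin (m + 1) → ℕ => ∏ i, f i (l i)) ∘ (Fin.consEquiv fun _ => ℕ) =
        fun z : ℕ × (Fin m → ℕ) => f 0 z.1 * ∏ i, f i.succ (z.2 i) := by
      ext z
      simp [Fin.prod_univ_succ, Fin.consEquiv]
    rw [h3]
    exact h

theorem antitone_of_mem_parts {m k : ℕ} {τ : Fin m → ℕ} (h : τ ∈ parts m k) : Antitone τ :=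
  (Finset.mem_filter.1 h).2

theorem sum_of_mem_parts {m k : ℕ} {τ : Fin m → ℕ} (h : τ ∈ parts m k) : ∑ i, τ i = k := by
  simpa using (Finset.mem_filter.1 h).1

theorem mem_parts {m k : ℕ} {τ : Fin m → ℕ} :
    τ ∈ parts m k ↔ ∑ i, τ i = k ∧ Antitone τ := by
  simp [parts]

theorem exists_antitone_add_stair {m : ℕ} {d : Fin m → ℕ} (hd : StrictAnti d) :
    ∃ τ : Fin m → ℕ, Antitone τ ∧ τ + stair m = d := by
  have hle : stair m ≤ d := fun i => by
    have hi := i.isLt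
    have := gap_of_strictAnti hd (m - 1 - i) i ⟨m - 1, by omega⟩ (by simp only; omega)
    simp only [stair]
    omega
  refine ⟨d - stair m, fun i j hij => ?_, tsub_add_cancel_of_le hle⟩
  have hj := j.isLt
  have hij' : (i : ℕ) ≤ j := hij
  have h1 := gap_of_strictAnti hd (j - i) i j (by omega)
  have h2 := hle i
  have h3 := hle j
  simp only [Pi.sub_apply, stair] at h2 h3 ⊢
  omega

/-- The exponents `(τ + δ) ∘ σ` of a partition `τ` and a permutation `σ`. -/
def permutedExponents (m : ℕ) (z : (Σ k, parts m k) × Equiv.Perm (Fin m)) : Fin m → ℕ :=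
  (z.1.2.1 + stair m) ∘ z.2

/-- A strictly decreasing sequence is determined by its range, and then `σ` by its values. -/
theorem permutedExponents_injective (m : ℕ) : Function.Injective (permutedExponents m) := by
  rintro ⟨⟨k, τ, hτ⟩, σ⟩ ⟨⟨k', τ', hτ'⟩, σ'⟩ h
  simp only [permutedExponents] at h
  have h1 := (antitone_of_mem_parts hτ).add_strictAnti (stair_strictAnti m)
  have h2 := (antitone_of_mem_parts hτ').add_strictAnti (stair_strictAnti m)
  have hr : Set.range (τ + stair m) = Set.range (τ' + stair m) := by
    rw [← σ.surjective.range_comp, h, σ'.surjective.range_comp]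
  have h3 : τ + stair m = τ' + stair m := by
    have h4 : Set.range (OrderDual.toDual ∘ (τ + stair m)) =
        Set.range (OrderDual.toDual ∘ (τ' + stair m)) := by
      rw [Set.range_comp, Set.range_comp, hr]
    have h5 : StrictMono (OrderDual.toDual ∘ (τ + stair m)) := fun i j hij => h1 hij
    have h6 : StrictMono (OrderDual.toDual ∘ (τ' + stair m)) := fun i j hij => h2 hij
    exact (StrictMono.range_inj h5 h6).1 h4
  have h7 : τ = τ' := add_right_cancel h3
  subst h7
  have h8 : σ = σ' := Equiv.ext fun i => h1.injective (congrFun h i)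
  have h9 : k = k' := (sum_of_mem_parts hτ).symm.trans (sum_of_mem_parts hτ')
  subst h9 h8
  rfl

theorem mem_range_permutedExponents {m : ℕ} {d : Fin m → ℕ} (hd : Function.Injective d) :
    d ∈ Set.range (permutedExponents m) := by
  set s := Tuple.sort (fun i => OrderDual.toDual (d i))
  have hs : StrictAnti (d ∘ s) := by
    have := (Tuple.monotone_sort (fun i => OrderDual.toDual (d i))).strictMono_of_injective
      ((OrderDual.toDual.injective.comp hd).comp (Equiv.injective _))
    exact fun i j hij => this hij
  obtain ⟨τ, hτ, hτd⟩ := exists_antitone_add_stair hs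
  refine ⟨(⟨∑ i, τ i, τ, mem_parts.2 ⟨rfl, hτ⟩⟩, s.symm), ?_⟩
  simp only [permutedExponents, hτd]
  ext i
  simp

/-- Expanding the determinant of sums gives a sum over all `l : Fin m → ℕ`. Non-injective `l` repeat
a row and drop out; the others are grouped by their decreasing rearrangement, and each orbit of
permutations assembles the second determinant. -/
theorem hasSum_det_mul_det {m : ℕ} (a c : ℕ → Fin m → ℝ)
    (h : ∀ i j, Summable fun k => a k i * c k j) :
    HasSum (fun k => ∑ τ ∈ parts m k,
        (Matrix.of fun r j : Fin m => a ((τ + stair m) r) j).det *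
          (Matrix.of fun r j : Fin m => c ((τ + stair m) r) j).det)
      (Matrix.of fun i j : Fin m => ∑' k, a k i * c k j).det := by
  have h1 : HasSum (fun l : Fin m → ℕ =>
      (Matrix.of fun r j : Fin m => a (l r) j).det * ∏ i, c (l i) i)
      (Matrix.of fun i j : Fin m => ∑' k, a k i * c k j).det := by
    have h2 := hasSum_sum fun (σ : Equiv.Perm (Fin m)) (_ : σ ∈ Finset.univ) =>
      (hasSum_prod_pi (fun i k => a k (σ i) * c k i) fun i => h _ _).mul_left
        ((Equiv.Perm.sign σ : ℤ) : ℝ)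
    rw [Matrix.det_apply']
    refine h2.congr_fun ?_
    intro l
    rw [← Matrix.det_transpose, Matrix.det_apply', Finset.sum_mul]
    refine Finset.sum_congr rfl fun σ _ => ?_
    rw [Finset.prod_mul_distrib, mul_assoc]
    rfl
  rw [← (permutedExponents_injective m).hasSum_iff] at h1
  · have h3 := (h1.prod_fiberwise fun _ => hasSum_fintype _).sigma fun _ => hasSum_fintype _
    refine h3.congr_fun ?_
    intro k
    rw [← Finset.sum_coe_sort]
    refine Finset.sum_congr rfl fun τ _ => ?_
    rw [Matrix.det_apply' (Matrix.of fun r j : Fin m => c ((τ.1 + stair m) r) j), Finset.mul_sum]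
    refine Finset.sum_congr rfl fun σ _ => ?_
    have h4 := Matrix.det_permute σ (Matrix.of fun r j : Fin m => a ((τ.1 + stair m) r) j)
    simp only [Function.comp_def, permutedExponents] at h4 ⊢
    rw [← mul_assoc, mul_comm (Matrix.det _) ((Equiv.Perm.sign σ : ℤ) : ℝ), ← h4]
    rfl
  · intro l hl
    have hi : ¬ Function.Injective l := fun hi => hl (mem_range_permutedExponents hi)
    simp only [Function.Injective, not_forall] at hi
    obtain ⟨i, j, hij, hne⟩ := hi
    rw [Matrix.det_zero_of_row_eq hne, zero_mul]
    ext k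
    simp [hij]

/-! ### Convergence of the scalar series -/

theorem scalarTerm_eq {p q : ℕ} (a : Fin p → ℝ) (e : Fin q → ℝ) (z : ℝ) (k : ℕ) :
    scalarTerm a e z k = scalarTerm a e 1 k * z ^ k := by
  simp only [scalarTerm, one_pow]
  ring

theorem scalarTerm_pos {p q : ℕ} {a : Fin p → ℝ} {e : Fin q → ℝ} (ha : ∀ i, 0 < a i)
    (he : ∀ j, 0 < e j) {z : ℝ} (hz : 0 < z) (k : ℕ) : 0 < scalarTerm a e z k :=
  mul_pos (div_pos (Finset.prod_pos fun i _ => ascPochhammer_pos _ _ (ha i))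
    (Finset.prod_pos fun j _ => ascPochhammer_pos _ _ (he j))) (by positivity)

/-- Ratio test. With the defect `d = q + 1 - p` the limit is `z * 0 ^ d`, which covers both regimes
since `0 ^ 0 = 1`. -/
theorem summable_scalarTerm {p q d : ℕ} {a : Fin p → ℝ} {e : Fin q → ℝ} (ha : ∀ i, 0 < a i)
    (he : ∀ j, 0 < e j) {z : ℝ} (hz : 0 < z) (hd : p + d = q + 1) (hzd : z * 0 ^ d < 1) :
    Summable (scalarTerm a e z) := by
  refine summable_of_ratio_test_tendsto_lt_one hzd
    (Filter.Eventually.of_forall fun k => (scalarTerm_pos ha he hz k).ne') ?_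
  have h1 : ∀ s t : ℝ, Filter.Tendsto (fun k : ℕ => (s + k) / (t + k)) Filter.atTop (𝓝 1) := by
    intro s t
    simpa using tendsto_add_mul_div_add_mul_atTop_nhds s t 1 (one_ne_zero (α := ℝ))
  have h2 := ((tendsto_finsetProd Finset.univ fun i _ => h1 (a i) 1).mul
    (tendsto_finsetProd Finset.univ fun j _ => h1 1 (e j))).mul
    ((tendsto_one_div_add_atTop_nhds_zero_nat (𝕜 := ℝ)).pow d |>.const_mul z)
  simp only [Finset.prod_const_one, one_mul] at h2
  refine h2.congr fun k => ?_
  rw [Real.norm_of_nonneg (scalarTerm_pos ha he hz _).le,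
    Real.norm_of_nonneg (scalarTerm_pos ha he hz _).le]
  have hk : (0 : ℝ) < k + 1 := by positivity
  have hA : ∏ i, (ascPochhammer ℝ k).eval (a i) ≠ 0 :=
    (Finset.prod_pos fun i _ => ascPochhammer_pos _ _ (ha i)).ne'
  have hE : ∏ j, (ascPochhammer ℝ k).eval (e j) ≠ 0 :=
    (Finset.prod_pos fun i _ => ascPochhammer_pos _ _ (he i)).ne'
  have hE' : ∏ j, (e j + (k : ℝ)) ≠ 0 :=
    (Finset.prod_pos fun j _ => add_pos_of_pos_of_nonneg (he j) k.cast_nonneg).ne'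
  have hpow : ((k : ℝ) + 1) ^ p * (k + 1) ^ d = (k + 1) ^ q * (k + 1) := by
    rw [← pow_add, hd, pow_succ]
  simp only [scalarTerm, ascPochhammer_succ_eval, Finset.prod_mul_distrib, Finset.prod_div_distrib,
    add_comm (1 : ℝ), Finset.prod_const, Finset.card_univ, Fintype.card_fin, Nat.factorial_succ,
    Nat.cast_mul, Nat.cast_succ, one_div, inv_pow, pow_succ z]
  have hf : (k.factorial : ℝ) ≠ 0 := by positivity
  field_simp
  rw [mul_assoc _ (_ ^ p), hpow]
  ring

/-- Room beyond the sup norms is needed for the divided-difference bound. If `p = q + 1`, the norms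
are attained at entries, so `‖b‖ * ‖c‖ < 1` and both radii can be enlarged slightly. -/
theorem exists_radii {m p q : ℕ} {a : Fin p → ℝ} {e : Fin q → ℝ} (ha : ∀ i, 0 < a i)
    (he : ∀ j, 0 < e j) (b c : Fin m → ℝ)
    (hpq : p ≤ q ∨ (p = q + 1 ∧ ∀ l f, |b l * c f| < 1)) :
    ∃ s t : ℝ, ‖b‖ < s ∧ ‖c‖ < t ∧ Summable (scalarTerm a e (s * t)) := by
  have hb := norm_nonneg b
  have hc := norm_nonneg c
  rcases hpq with h | ⟨h, hbc⟩
  · refine ⟨‖b‖ + 1, ‖c‖ + 1, by linarith, by linarith,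
      summable_scalarTerm (d := q + 1 - p) ha he (by positivity) (by omega) ?_⟩
    rw [zero_pow (by omega), mul_zero]
    exact zero_lt_one
  · have hlt : ‖b‖ * ‖c‖ < 1 := by
      rcases isEmpty_or_nonempty (Fin m) with hm | hm
      · rw [Subsingleton.elim b 0]
        simp
      · obtain ⟨i, hi⟩ := Finite.exists_max fun i => ‖b i‖
        obtain ⟨j, hj⟩ := Finite.exists_max fun j => ‖c j‖
        have h1 := (pi_norm_le_iff_of_nonneg (norm_nonneg _)).2 hi
        have h2 := (pi_norm_le_iff_of_nonneg (norm_nonneg _)).2 hj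
        refine (mul_le_mul h1 h2 hc (norm_nonneg _)).trans_lt ?_
        rw [← norm_mul]
        exact hbc i j
    have hcont : Filter.Tendsto (fun ε : ℝ => (‖b‖ + ε) * (‖c‖ + ε)) (𝓝[>] 0)
        (𝓝 ((‖b‖ + 0) * (‖c‖ + 0))) :=
      ((by fun_prop : Continuous fun ε : ℝ => (‖b‖ + ε) * (‖c‖ + ε)).tendsto 0).mono_left
        nhdsWithin_le_nhds
    obtain ⟨ε, hε, hε0⟩ := ((hcont.eventually_lt_const
      (by simpa using hlt : _ < (1 : ℝ))).and self_mem_nhdsWithin).exists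
    have hε0 : 0 < ε := hε0
    exact ⟨‖b‖ + ε, ‖c‖ + ε, by linarith, by linarith,
      summable_scalarTerm (d := 0) ha he (by positivity) (by omega) (by simpa using hε)⟩

/-! ### The regularized determinant -/

/-- The matrix `∑ₖ wₖ D_{k,i}(x) D_{k,j}(y)` for the weights `w` of a scalar hypergeometric series
and the divided differences `D_{k,i}` of `t ^ k`. -/
noncomputable def dividedMatrix {m p q : ℕ} (a : Fin p → ℝ) (e : Fin q → ℝ) (x y : Fin m → ℝ) :
    Matrix (Fin m) (Fin m) ℝ :=
  Matrix.of fun i j => ∑' k, scalarTerm a e 1 k * newtonCoeff (extendZero x) k i *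
    newtonCoeff (extendZero y) k j

section

variable {m p q : ℕ} {a : Fin p → ℝ} {e : Fin q → ℝ}

/-- A majorant depending on `x`, `y` only through `r`, `r'`: it gives both summability and uniform
convergence. -/
theorem abs_dividedMatrix_term_le (ha : ∀ i, 0 < a i) (he : ∀ j, 0 < e j) {x y : Fin m → ℝ}
    {r s r' s' : ℝ} (hx : ‖x‖ ≤ r) (hrs : r < s) (hy : ‖y‖ ≤ r') (hrs' : r' < s') (k i j : ℕ) :
    ‖scalarTerm a e 1 k * newtonCoeff (extendZero x) k i * newtonCoeff (extendZero y) k j‖ ≤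
      (s - r)⁻¹ ^ i * (s' - r')⁻¹ ^ j * scalarTerm a e (s * s') k := by
  have hb : ∀ {x : Fin m → ℝ} {r s : ℝ}, ‖x‖ ≤ r → r < s → ∀ i,
      |newtonCoeff (extendZero x) k i| ≤ (s - r)⁻¹ ^ i * s ^ k := fun hx hrs i =>
    abs_newtonCoeff_le (abs_extendZero_le ((norm_nonneg _).trans hx)
      fun i => (norm_le_pi_norm _ i).trans hx) hrs k i
  have hw := scalarTerm_pos ha he one_pos k
  rw [norm_mul, norm_mul, Real.norm_of_nonneg hw.le, scalarTerm_eq a e (s * s'), mul_pow]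
  calc scalarTerm a e 1 k * ‖newtonCoeff (extendZero x) k i‖ * ‖newtonCoeff (extendZero y) k j‖
      ≤ scalarTerm a e 1 k * ((s - r)⁻¹ ^ i * s ^ k) * ((s' - r')⁻¹ ^ j * s' ^ k) := by
        have h1 := hb hx hrs i
        have h2 := hb hy hrs' j
        exact mul_le_mul (mul_le_mul_of_nonneg_left h1 hw.le) h2 (norm_nonneg _)
          (mul_nonneg hw.le ((abs_nonneg _).trans h1))
    _ = _ := by ring

theorem summable_dividedMatrix_term (ha : ∀ i, 0 < a i) (he : ∀ j, 0 < e j) {x y : Fin m → ℝ}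
    {s t : ℝ} (hx : ‖x‖ < s) (hy : ‖y‖ < t) (h : Summable (scalarTerm a e (s * t))) (i j : ℕ) :
    Summable fun k => scalarTerm a e 1 k * newtonCoeff (extendZero x) k i *
      newtonCoeff (extendZero y) k j :=
  Summable.of_norm_bounded (h.mul_left _)
    fun k => abs_dividedMatrix_term_le ha he le_rfl hx le_rfl hy k i j

theorem eventually_norm_lt_and_norm_lt {b c : Fin m → ℝ} {s t : ℝ} (hb : ‖b‖ < s) (hc : ‖c‖ < t) :
    ∀ᶠ z : (Fin m → ℝ) × (Fin m → ℝ) in 𝓝 (b, c), ‖z.1‖ < s ∧ ‖z.2‖ < t :=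
  ((continuous_fst.norm.tendsto (b, c)).eventually_lt_const hb).and
    ((continuous_snd.norm.tendsto (b, c)).eventually_lt_const hc)

theorem continuousAt_det_dividedMatrix (ha : ∀ i, 0 < a i) (he : ∀ j, 0 < e j) {b c : Fin m → ℝ}
    {s t : ℝ} (hb : ‖b‖ < s) (hc : ‖c‖ < t) (h : Summable (scalarTerm a e (s * t))) :
    ContinuousAt (fun z : (Fin m → ℝ) × (Fin m → ℝ) => (dividedMatrix a e z.1 z.2).det) (b, c) := by
  -- Intermediate radii make the majorant uniform on a neighbourhood of `(b, c)`.
  obtain ⟨r, hbr, hrs⟩ := exists_between hb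
  obtain ⟨r', hcr, hrt⟩ := exists_between hc
  set U : Set ((Fin m → ℝ) × (Fin m → ℝ)) := {z | ‖z.1‖ < r ∧ ‖z.2‖ < r'}
  have hU : U ∈ 𝓝 (b, c) := eventually_norm_lt_and_norm_lt hbr hcr
  suffices h1 : ∀ i j, ContinuousOn (fun z : (Fin m → ℝ) × (Fin m → ℝ) =>
      dividedMatrix a e z.1 z.2 i j) U by
    simp only [ContinuousAt, Matrix.det_apply']
    exact tendsto_finsetSum _ fun σ _ => tendsto_const_nhds.mul
      (tendsto_finsetProd _ fun i _ => (h1 _ _).continuousAt hU)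
  intro i j
  refine continuousOn_tsum (fun k => Continuous.continuousOn ?_) (h.mul_left _)
    fun k z hz => abs_dividedMatrix_term_le ha he hz.1.le hrs hz.2.le hrt k i j
  exact (continuous_const.mul (continuous_newtonCoeff
    (fun i => (continuous_extendZero i).comp continuous_fst) k i)).mul
    (continuous_newtonCoeff (fun i => (continuous_extendZero i).comp continuous_snd) k j)

theorem det_scalarHyp (ha : ∀ i, 0 < a i) (he : ∀ j, 0 < e j) {x y : Fin m → ℝ}
    {s t : ℝ} (hx : ‖x‖ < s) (hy : ‖y‖ < t) (h : Summable (scalarTerm a e (s * t))) :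
    (Matrix.of fun l f : Fin m => scalarHyp a e (x l * y f)).det =
      vand x * vand y * (dividedMatrix a e x y).det := by
  have hM : (Matrix.of fun l f : Fin m => scalarHyp a e (x l * y f)) =
      newtonBasis x * dividedMatrix a e x y * (newtonBasis y).transpose := by
    ext l f
    have h1 : HasSum (scalarTerm a e (x l * y f))
        (∑ j, (∑ i, newtonBasis x l i * dividedMatrix a e x y i j) * newtonBasis y f j) := by
      refine (hasSum_sum fun (j : Fin m) (_ : j ∈ Finset.univ) => (hasSum_sum fun (i : Fin m)
        (_ : i ∈ Finset.univ) => (summable_dividedMatrix_term ha he hx hy h i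
          j).hasSum.mul_left (newtonBasis x l i)).mul_right (newtonBasis y f j)).congr_fun
            fun k => ?_
      rw [scalarTerm_eq, mul_pow, pow_eq_sum_newtonBasis, pow_eq_sum_newtonBasis,
        ← mul_assoc, Finset.mul_sum, Finset.mul_sum]
      refine Finset.sum_congr rfl fun j _ => ?_
      rw [Finset.sum_mul, Finset.sum_mul]
      exact Finset.sum_congr rfl fun i _ => by ring
    simpa only [Matrix.mul_apply, Matrix.transpose_apply, Matrix.of_apply, scalarHyp] using
      h1.tsum_eq
  rw [hM, Matrix.det_mul, Matrix.det_mul, Matrix.det_transpose, det_newtonBasis, det_newtonBasis,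
    vand_mul_vand]
  ring

theorem hasSum_det_dividedMatrix (ha : ∀ i, 0 < a i) (he : ∀ j, 0 < e j) {x y : Fin m → ℝ}
    {s t : ℝ} (hx : ‖x‖ < s) (hy : ‖y‖ < t) (h : Summable (scalarTerm a e (s * t))) :
    HasSum (fun k => ∑ τ ∈ parts m k, (∏ r, scalarTerm a e 1 ((τ + stair m) r)) *
      MvPolynomial.eval x (schur τ) * MvPolynomial.eval y (schur τ))
      (dividedMatrix a e x y).det := by
  refine (hasSum_det_mul_det (fun k (i : Fin m) => scalarTerm a e 1 k *
    newtonCoeff (extendZero x) k i) (fun k (j : Fin m) => newtonCoeff (extendZero y) k j)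
    fun i j => summable_dividedMatrix_term ha he hx hy h i j).congr_fun fun k => ?_
  refine Finset.sum_congr rfl fun τ _ => ?_
  have h1 := Matrix.det_mul_column (fun r : Fin m => scalarTerm a e 1 ((τ + stair m) r))
    (Matrix.of fun r k : Fin m => newtonCoeff (extendZero x) ((τ + stair m) r) k)
  simp only [Matrix.of_apply] at h1
  rw [h1, eval_schur, eval_schur]
  have hε : ((Equiv.Perm.sign (Fin.revPerm (n := m)) : ℤ) : ℝ) *
      ((Equiv.Perm.sign (Fin.revPerm (n := m)) : ℤ) : ℝ) = 1 := by
    rcases Int.units_eq_one_or (Equiv.Perm.sign (Fin.revPerm (n := m))) with h | h <;> simp [h]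
  rw [← mul_one (_ * _ * Matrix.det _), ← hε]
  ring

end

/-! ### Comparison of the coefficients -/

theorem gamma_add_nat {z : ℝ} (hz : 0 < z) (n : ℕ) :
    Real.Gamma (z + n) = Real.Gamma z * (ascPochhammer ℝ n).eval z := by
  induction n with
  | zero => simp
  | succ n ih =>
    rw [ascPochhammer_succ_eval, Nat.cast_succ, ← add_assoc,
      Real.Gamma_add_one (by positivity), ih]
    ring

theorem multiGamma_pos {m : ℕ} {ν : ℝ} (hν : -1 < ν) : 0 < multiGamma m ((m : ℝ) + ν) := by
  refine mul_pos (Real.rpow_pos_of_pos Real.pi_pos _) (Finset.prod_pos fun r _ => ?_)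
  refine Real.Gamma_pos_of_pos ?_
  have : ((r : ℕ) : ℝ) + 1 ≤ m := by exact_mod_cast r.isLt
  linarith

/-- The `r`-th numerator is `Γ((ν + 1) + (τ_r + δ_r))`; the power of `π` cancels the one inside
`multiGamma`. -/
theorem genPochhammer_eq {m : ℕ} {ν : ℝ} (hν : -1 < ν) (τ : Fin m → ℕ) :
    genPochhammer ((m : ℝ) + ν) τ =
      Real.pi ^ ((m : ℝ) * ((m : ℝ) - 1) / 2) *
        (Real.Gamma (ν + 1) ^ m / multiGamma m ((m : ℝ) + ν)) *
        ∏ r, (ascPochhammer ℝ ((τ + stair m) r)).eval (ν + 1) := by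
  have h1 : ∀ r : Fin m, Real.Gamma ((m : ℝ) + ν + τ r - (r : ℕ)) =
      Real.Gamma (ν + 1) * (ascPochhammer ℝ ((τ + stair m) r)).eval (ν + 1) := fun r => by
    rw [← gamma_add_nat (by linarith)]
    congr 1
    have h2 : (stair m r : ℝ) = m - 1 - (r : ℕ) := by
      have h3 : stair m r + 1 + r = m := by
        have := r.isLt
        simp only [stair]
        omega
      have h4 : (stair m r : ℝ) + 1 + (r : ℕ) = m := by exact_mod_cast h3
      linarith
    rw [Pi.add_apply, Nat.cast_add, h2]
    ring
  have hpi : Real.pi ^ ((m : ℝ) * ((m : ℝ) - 1) / 2) ≠ 0 :=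
    (Real.rpow_pos_of_pos Real.pi_pos _).ne'
  simp only [genPochhammer, multiGamma, h1, Finset.prod_div_distrib, Finset.prod_mul_distrib,
    Finset.prod_const, Finset.card_univ, Fintype.card_fin]
  field_simp

theorem multiGamma_self (m : ℕ) :
    multiGamma m m = Real.pi ^ ((m : ℝ) * ((m : ℝ) - 1) / 2) * ∏ r, ((stair m r).factorial : ℝ) := by
  rw [multiGamma]
  congr 1
  refine Finset.prod_congr rfl fun r _ => ?_
  rw [← Real.Gamma_nat_eq_factorial]
  congr 1
  have h3 : stair m r + 1 + r = m := by
    have := r.isLt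
    simp only [stair]
    omega
  have h4 : (stair m r : ℝ) + 1 + (r : ℕ) = m := by exact_mod_cast h3
  linarith

/-- The constant in front of the determinant in `detSide`. -/
noncomputable def detConst (m : ℕ) {p q : ℕ} (μ : Fin p → ℝ) (φ : Fin q → ℝ) : ℝ :=
  Real.pi ^ ((m : ℝ) * ((m : ℝ) - 1) / 2 * ((p : ℝ) - (q : ℝ) - 1)) * multiGamma m m *
    (∏ i, Real.Gamma (μ i + 1) ^ m / multiGamma m ((m : ℝ) + μ i)) *
    (∏ j, multiGamma m ((m : ℝ) + φ j) / Real.Gamma (φ j + 1) ^ m)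

section

variable {m p q : ℕ} {μ : Fin p → ℝ} {φ : Fin q → ℝ}

/-- The `p - q` powers of `π` come from the Pochhammer symbols, and the extra `-1` removes the one
in `Γ_m(m)`, leaving `∏ δ_r!`. The factorials on the right undo the `1 / k!` of the scalar terms. -/
theorem prod_genPochhammer_div (hμ : ∀ i, -1 < μ i) (hφ : ∀ j, -1 < φ j) (τ : Fin m → ℕ) :
    (∏ i, genPochhammer ((m : ℝ) + μ i) τ) / (∏ j, genPochhammer ((m : ℝ) + φ j) τ) *
      (∏ r, ((stair m r).factorial : ℝ)) =
    detConst m μ φ * (∏ r, scalarTerm (fun i => μ i + 1) (fun j => 1 + φ j) 1 ((τ + stair m) r)) *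
      ∏ r, (((τ + stair m) r).factorial : ℝ) := by
  set P := Real.pi ^ ((m : ℝ) * ((m : ℝ) - 1) / 2) with hP
  have hP0 : P ≠ 0 := (Real.rpow_pos_of_pos Real.pi_pos _).ne'
  have hpow : Real.pi ^ ((m : ℝ) * ((m : ℝ) - 1) / 2 * ((p : ℝ) - (q : ℝ) - 1)) =
      P ^ p / P ^ q / P := by
    rw [mul_sub, mul_sub, mul_one, Real.rpow_sub Real.pi_pos, Real.rpow_sub Real.pi_pos,
      Real.rpow_mul Real.pi_pos.le, Real.rpow_mul Real.pi_pos.le, Real.rpow_natCast,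
      Real.rpow_natCast]
  have hφm : ∏ j, multiGamma m ((m : ℝ) + φ j) ≠ 0 :=
    (Finset.prod_pos fun j _ => multiGamma_pos (hφ j)).ne'
  have hφg : ∏ j, Real.Gamma (φ j + 1) ^ m ≠ 0 :=
    (Finset.prod_pos fun j _ => pow_pos (Real.Gamma_pos_of_pos (by linarith [hφ j])) _).ne'
  have hμm : ∏ i, multiGamma m ((m : ℝ) + μ i) ≠ 0 :=
    (Finset.prod_pos fun j _ => multiGamma_pos (hμ j)).ne'
  have hfac : ∏ r, (((τ + stair m) r).factorial : ℝ) ≠ 0 :=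
    Finset.prod_ne_zero_iff.2 fun r _ => by positivity
  have hasc : ∏ r, ∏ j, (ascPochhammer ℝ ((τ + stair m) r)).eval (φ j + 1) ≠ 0 :=
    (Finset.prod_pos fun r _ => Finset.prod_pos fun j _ =>
      ascPochhammer_pos _ _ (by linarith [hφ j])).ne'
  have hμG : ∏ i, genPochhammer ((m : ℝ) + μ i) τ = _ :=
    Finset.prod_congr rfl fun i _ => genPochhammer_eq (hμ i) τ
  have hφG : ∏ j, genPochhammer ((m : ℝ) + φ j) τ = _ :=
    Finset.prod_congr rfl fun j _ => genPochhammer_eq (hφ j) τ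
  rw [hμG, hφG, detConst, hpow, multiGamma_self, ← hP]
  simp only [scalarTerm, Finset.prod_mul_distrib, Finset.prod_div_distrib, Finset.prod_const,
    Finset.card_univ, Fintype.card_fin, one_pow, add_comm (1 : ℝ)]
  rw [Finset.prod_comm (s := (Finset.univ : Finset (Fin p))),
    Finset.prod_comm (s := (Finset.univ : Finset (Fin q)))]
  field_simp

theorem matrixTerm_eq (hμ : ∀ i, -1 < μ i) (hφ : ∀ j, -1 < φ j)
    {B C : Matrix (Fin m) (Fin m) ℂ} (hB : B.IsHermitian) (hC : C.IsHermitian)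
    {b c : Fin m → ℝ}
    (hb : B.charpoly = ∏ l, (Polynomial.X - Polynomial.C (b l : ℂ)))
    (hc : C.charpoly = ∏ f, (Polynomial.X - Polynomial.C (c f : ℂ))) (k : ℕ) :
    matrixTerm (fun i => (m : ℝ) + μ i) (fun j => (m : ℝ) + φ j) B C hB hC k =
      detConst m μ φ * ∑ τ ∈ parts m k,
        (∏ r, scalarTerm (fun i => μ i + 1) (fun j => 1 + φ j) 1 ((τ + stair m) r)) *
          MvPolynomial.eval b (schur τ) * MvPolynomial.eval c (schur τ) := by
  rw [matrixTerm, Finset.mul_sum]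
  refine Finset.sum_congr rfl fun τ hτ => ?_
  have h1 : (1 : Matrix (Fin m) (Fin m) ℂ).charpoly =
      ∏ l : Fin m, (Polynomial.X - Polynomial.C (((1 : Fin m → ℝ) l : ℝ) : ℂ)) := by
    simp [Matrix.charpoly_one]
  rw [zonal_eq τ hB hb, zonal_eq τ hC hc, zonal_eq τ Matrix.isHermitian_one h1]
  have hz := zonalCoeff_eq τ
  rw [sum_of_mem_parts hτ] at hz
  have hs := eval_one_schur_ne_zero (antitone_of_mem_parts hτ)
  have hk : (k.factorial : ℝ) ≠ 0 := by positivity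
  have hfac : ∏ r, (((τ + stair m) r).factorial : ℝ) ≠ 0 :=
    Finset.prod_ne_zero_iff.2 fun r _ => by positivity
  have hst : ∏ r, ((stair m r).factorial : ℝ) ≠ 0 :=
    Finset.prod_ne_zero_iff.2 fun r _ => by positivity
  have hz0 : zonalCoeff τ ≠ 0 := by
    intro h
    rw [h, zero_mul] at hz
    exact mul_ne_zero (mul_ne_zero hk hs) hst hz.symm
  have hw := prod_genPochhammer_div hμ hφ τ
  refine mul_right_cancel₀ hfac ?_
  generalize ∏ i, genPochhammer ((m : ℝ) + μ i) τ = M at hw ⊢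
  generalize ∏ j, genPochhammer ((m : ℝ) + φ j) τ = E at hw ⊢
  generalize MvPolynomial.eval b (schur τ) = β
  generalize MvPolynomial.eval c (schur τ) = γ
  calc _ = M / E * (zonalCoeff τ * ∏ r, (((τ + stair m) r).factorial : ℝ)) *
        (β * γ) / (MvPolynomial.eval 1 (schur τ) * k.factorial) := by
        -- For `E = 0` both sides are zero by the convention for division, so no nonvanishing is
        -- needed.
        rcases eq_or_ne E 0 with rfl | hE
        · simp
        · field_simp
    _ = M / E * (∏ r, ((stair m r).factorial : ℝ)) * (β * γ) := by
        rw [hz]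
        field_simp
    _ = _ := by
        rw [hw]
        ring

theorem detSide_eq (hμ : ∀ i, -1 < μ i) (hφ : ∀ j, -1 < φ j) {x y : Fin m → ℝ} {s t : ℝ}
    (hx : ‖x‖ < s) (hy : ‖y‖ < t)
    (h : Summable (scalarTerm (fun i => μ i + 1) (fun j => 1 + φ j) (s * t)))
    (hxi : Function.Injective x) (hyi : Function.Injective y) :
    detSide μ φ x y = detConst m μ φ *
      (dividedMatrix (fun i => μ i + 1) (fun j => 1 + φ j) x y).det := by
  have hV : vand x * vand y ≠ 0 := by
    rw [vand_mul_vand]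
    exact mul_ne_zero (Matrix.det_vandermonde_ne_zero_iff.2 hxi)
      (Matrix.det_vandermonde_ne_zero_iff.2 hyi)
  rw [detSide, det_scalarHyp (fun i => by linarith [hμ i]) (fun j => by linarith [hφ j]) hx hy h,
    mul_div_cancel_left₀ _ hV, detConst]

end

end HermitianHypergeometric

theorem lemma3 {m p q : ℕ} (μ : Fin p → ℝ) (φ : Fin q → ℝ)
    (hμ : ∀ i, -1 < μ i) (hφ : ∀ j, -1 < φ j)
    (B C : Matrix (Fin m) (Fin m) ℂ) (hB : B.IsHermitian) (hC : C.IsHermitian)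
    (b c : Fin m → ℝ)
    (hb : B.charpoly = ∏ l, (Polynomial.X - Polynomial.C (b l : ℂ)))
    (hc : C.charpoly = ∏ f, (Polynomial.X - Polynomial.C (c f : ℂ)))
    (hpq : p ≤ q ∨ (p = q + 1 ∧ ∀ l f, |b l * c f| < 1)) :
    Summable (HermitianHypergeometric.matrixTerm
        (fun i => (m : ℝ) + μ i) (fun j => (m : ℝ) + φ j) B C hB hC) ∧
    (∀ l f, Summable (HermitianHypergeometric.scalarTerm
        (fun i => μ i + 1) (fun j => 1 + φ j) (b l * c f))) ∧
    (Function.Injective b → Function.Injective c →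
      HermitianHypergeometric.matrixHyp
        (fun i => (m : ℝ) + μ i) (fun j => (m : ℝ) + φ j) B C hB hC =
        HermitianHypergeometric.detSide μ φ b c) ∧
    Filter.Tendsto (fun z : (Fin m → ℝ) × (Fin m → ℝ) =>
        HermitianHypergeometric.detSide μ φ z.1 z.2)
      (𝓝[{z | Function.Injective z.1 ∧ Function.Injective z.2}] (b, c))
      (𝓝 (HermitianHypergeometric.matrixHyp
        (fun i => (m : ℝ) + μ i) (fun j => (m : ℝ) + φ j) B C hB hC)) := by
  have ha : ∀ i, 0 < μ i + 1 := fun i => by linarith [hμ i]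
  have he : ∀ j, 0 < 1 + φ j := fun j => by linarith [hφ j]
  obtain ⟨s, t, hbs, hct, hst⟩ := HermitianHypergeometric.exists_radii ha he b c hpq
  have hsum : HasSum (HermitianHypergeometric.matrixTerm
      (fun i => (m : ℝ) + μ i) (fun j => (m : ℝ) + φ j) B C hB hC) _ :=
    ((HermitianHypergeometric.hasSum_det_dividedMatrix ha he hbs hct hst).mul_left
      (HermitianHypergeometric.detConst m μ φ)).congr_fun
      fun k => HermitianHypergeometric.matrixTerm_eq hμ hφ hB hC hb hc k
  refine ⟨hsum.summable, fun l f => ?_, fun hbi hci => ?_, ?_⟩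
  -- Each `|b l * c f|` is at most `s * t`, where the series with positive coefficients converges.
  · refine Summable.of_norm_bounded hst fun k => ?_
    have hw := HermitianHypergeometric.scalarTerm_pos ha he one_pos k
    rw [HermitianHypergeometric.scalarTerm_eq, HermitianHypergeometric.scalarTerm_eq _ _ (s * t),
      norm_mul, Real.norm_of_nonneg hw.le, norm_pow, norm_mul]
    have h1 := (norm_le_pi_norm b l).trans hbs.le
    have h2 := (norm_le_pi_norm c f).trans hct.le
    have h3 : 0 ≤ s := (norm_nonneg _).trans h1
    gcongr
  · exact hsum.tsum_eq.trans
      (HermitianHypergeometric.detSide_eq hμ hφ hbs hct hst hbi hci).symm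
  · rw [HermitianHypergeometric.matrixHyp, hsum.tsum_eq]
    refine (((HermitianHypergeometric.continuousAt_det_dividedMatrix ha he hbs hct
      hst).tendsto.const_mul (HermitianHypergeometric.detConst m μ φ)).mono_left
      nhdsWithin_le_nhds).congr' ?_
    have h1 := HermitianHypergeometric.eventually_norm_lt_and_norm_lt hbs hct
    filter_upwards [nhdsWithin_le_nhds h1, self_mem_nhdsWithin] with z hz hzi
    exact (HermitianHypergeometric.detSide_eq hμ hφ hz.1 hz.2 hst hzi.1 hzi.2).symm
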